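/- Let $\ell\ge 1$ and $m\ge 2\ell-1$ be integers, and let $\mathcal N$ be a matroid on a finite ground set $V$, with rank function $\rho_{\mathcal N}$. Let $X_1,\dots,X_m\subseteq V$ be pairwise disjoint sets, and let $P$ be the partition matroid on $X_1\,\dot\cup\cdots\dot\cup\, X_m$, whose independent sets are the partial rainbow sets of $X_1,\dots,X_m$, that is, the selections of elements $x_1\in X_{a_1},\dots,x_r\in X_{a_r}$ with $1\le a_1<\dots<a_r\le m$. Assume that there are distinct indices $i_1,\dots,i_{2\ell-1}\in\{1,\dots,m\}$ such that $$\rho_{\mathcal N}(X_{i_j})\ \ge\ \min(j,\ell)\qquad\text{for all } 1\le j\le 2\ell-1 .$$ Let $P\cap\mathcal N$ be the simplicial complex of all sets that are independent in both $P$ and $\mathcal N$. Then $$\eta(P\cap\mathcal N)\ \ge\ \ell .$$ Here, for a simplicial complex $\mathcal C$ (a collection of finite sets closed under taking subsets), $\eta(\mathcal C)$ is the smallest integer $k$ such that the reduced homology group $\tilde H_{k-1}(\mathcal C;\mathbb Q)$ is nonzero, with $\eta(\mathcal C)=0$ if $\mathcal C$ is empty and $\eta(\mathcal C)=\infty$ if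 $\mathcal C$ is non-empty and all its reduced homology groups vanish. -/

import Mathlib

/-! ### Reduced simplicial homology over `ℚ`

An (abstract) simplicial complex on the vertices `α` is a collection of finite sets that is closed
under taking subsets, i.e. a term of `LowerSet (Finset α)`.  The empty set is a simplex of every
complex that has any simplices; it is the simplex of dimension `-1`, which makes the homology
below the reduced one.  A linear order on the vertices is used, as usual, to orient the
simplices. -/

namespace ReducedHomology

variable {α : Type*} [LinearOrder α]

/-- The sign of the vertex `v` in the simplex `s`: it is `(-1)^i` if `v` is the `i`-th vertex
(counted from `0`, in increasing order) of `s`. -/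
def sign (v : α) (s : Finset α) : ℚ := (-1) ^ (s.filter (fun w => w < v)).card

/-- The simplicial boundary map `∂ [v₀, …, vₖ] = ∑ᵢ (-1)^i [v₀, …, v̂ᵢ, …, vₖ]` (for
`v₀ < ⋯ < vₖ`), on formal `ℚ`-linear combinations of finite sets of vertices.  In particular
`∂ [v] = [∅]` and `∂ [∅] = 0`. -/
noncomputable def boundary : (Finset α →₀ ℚ) →ₗ[ℚ] (Finset α →₀ ℚ) :=
  Finsupp.linearCombination ℚ
    (fun s => ∑ v ∈ s, Finsupp.single (s.erase v) (sign v s))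

theorem boundary_single (s : Finset α) :
    boundary (Finsupp.single s 1) = ∑ v ∈ s, Finsupp.single (s.erase v) (sign v s) := by
  simp [boundary]

theorem sign_mul_sign_erase {s : Finset α} {v w : α} (hv : v ∈ s) (hvw : v < w) :
    sign v s * sign w (s.erase v) = -(sign w s * sign v (s.erase w)) := by
  have h1 : (s.erase w).filter (fun u => u < v) = s.filter (fun u => u < v) := by
    ext u
    simp only [Finset.mem_filter, Finset.mem_erase]
    constructor
    · rintro ⟨⟨_, h⟩, h'⟩
      exact ⟨h, h'⟩
    · rintro ⟨h, h'⟩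
      exact ⟨⟨(h'.trans hvw).ne, h⟩, h'⟩
  have h2 : (s.filter (fun u => u < w)).card
      = ((s.erase v).filter (fun u => u < w)).card + 1 := by
    rw [Finset.filter_erase, Finset.card_erase_add_one]
    simp [hv, hvw]
  simp only [sign, h1, h2, pow_succ]
  ring

/-- The boundary of a boundary is zero. -/
theorem boundary_boundary (c : Finset α →₀ ℚ) : boundary (boundary c) = 0 := by
  suffices h : (boundary (α := α)).comp boundary = 0 from LinearMap.congr_fun h c
  refine Finsupp.lhom_ext' fun s => LinearMap.ext_ring ?_
  have key : ∀ (t : Finset α) (a : ℚ), boundary (Finsupp.single t a)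
      = ∑ v ∈ t, Finsupp.single (t.erase v) (a * sign v t) := by
    intro t a
    simp [boundary, Finset.smul_sum]
  simp only [LinearMap.comp_apply, Finsupp.lsingle_apply, key, map_sum, one_mul,
    LinearMap.zero_apply]
  rw [Finset.sum_sigma']
  refine Finset.sum_involution (fun p _ => ⟨p.2, p.1⟩) ?_ ?_ ?_ ?_
  · rintro ⟨v, w⟩ h
    simp only [Finset.mem_sigma, Finset.mem_erase] at h
    obtain ⟨hv, hwv, hw⟩ := h
    simp only [Finset.erase_right_comm (a := w) (b := v)]
    rw [← Finsupp.single_add]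
    rcases lt_or_gt_of_ne hwv with hlt | hlt
    · rw [sign_mul_sign_erase hw hlt]
      simp
    · rw [sign_mul_sign_erase hv hlt]
      simp
  · rintro ⟨v, w⟩ h _ heq
    simp only [Finset.mem_sigma, Finset.mem_erase] at h
    simp only [Sigma.mk.injEq, heq_eq_eq] at heq
    exact h.2.1 heq.1
  · rintro ⟨v, w⟩ h
    simp only [Finset.mem_sigma, Finset.mem_erase] at h ⊢
    exact ⟨h.2.2, h.2.1.symm, h.1⟩
  · rintro ⟨v, w⟩ _
    rfl

/-- The chains of `K` of dimension `k - 1`: the formal `ℚ`-linear combinations of the simplices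
of `K` with exactly `k` vertices. -/
def chains (K : LowerSet (Finset α)) (k : ℕ) : Submodule ℚ (Finset α →₀ ℚ) :=
  Finsupp.supported ℚ ℚ {s : Finset α | s ∈ K ∧ s.card = k}

/-- The cycles of `K` of dimension `k - 1`. -/
noncomputable def cycles (K : LowerSet (Finset α)) (k : ℕ) : Submodule ℚ (Finset α →₀ ℚ) :=
  chains K k ⊓ LinearMap.ker boundary

/-- The boundaries of `K` of dimension `k - 1`. -/
noncomputable def boundaries (K : LowerSet (Finset α)) (k : ℕ) :
    Submodule ℚ (Finset α →₀ ℚ) :=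
  (chains K (k + 1)).map boundary

/-- Every boundary is a cycle. -/
theorem boundaries_le_cycles (K : LowerSet (Finset α)) (k : ℕ) :
    boundaries K k ≤ cycles K k := by
  refine le_inf ?_ ?_
  · rw [boundaries, chains, Finsupp.supported_eq_span_single, Submodule.map_span_le]
    rintro _ ⟨s, ⟨hs, hcard⟩, rfl⟩
    rw [boundary_single]
    refine Submodule.sum_mem _ fun v hv => Finsupp.single_mem_supported ℚ _ ⟨?_, ?_⟩
    · exact K.lower (Finset.erase_subset v s) hs
    · rw [Finset.card_erase_of_mem hv, hcard, Nat.add_sub_cancel]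
  · rintro _ ⟨c, _, rfl⟩
    exact boundary_boundary c

/-- The reduced homology `H̃_{k-1}(K; ℚ)` of `K` in dimension `k - 1`, for `k : ℕ`: the cycles
modulo the boundaries.  (In dimensions below `-1` there are no chains.) -/
abbrev reducedHomology (K : LowerSet (Finset α)) (k : ℕ) : Type _ :=
  ↥(cycles K k) ⧸ (boundaries K k).submoduleOf (cycles K k)

open scoped Classical in
/-- The homological connectivity `η(K)`: the smallest `k` such that `H̃_{k-1}(K; ℚ) ≠ 0`; it is
`0` if `K` is empty, and `∞` if `K` is non-empty and all its reduced homology vanishes. -/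
noncomputable def eta (K : LowerSet (Finset α)) : ℕ∞ :=
  if K = ⊥ then 0
  else sInf {n : ℕ∞ | ∃ k : ℕ, n = (k : ℕ∞) ∧ Nontrivial (reducedHomology K k)}

end ReducedHomology

/-! ### Partition matroids and the complex of independent sets -/

/-- `s` is a partial rainbow set of the family `X`: a selection of elements from members of
the family with pairwise distinct indices. -/
def IsPartialRainbow {α : Type*} {m : ℕ} (X : Fin m → Set α) (s : Set α) : Prop :=
  ∃ f : s → Fin m, Function.Injective f ∧ ∀ x : s, (x : α) ∈ X (f x)

namespace IsPartialRainbow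

variable {α : Type*} {m : ℕ} {X : Fin m → Set α}

theorem empty : IsPartialRainbow X ∅ :=
  ⟨fun x => x.2.elim, fun x => x.2.elim, fun x => x.2.elim⟩

theorem subset ⦃I J : Set α⦄ (hJ : IsPartialRainbow X J) (hIJ : I ⊆ J) :
    IsPartialRainbow X I := by
  obtain ⟨f, hf, hfX⟩ := hJ
  refine ⟨fun x => f ⟨x, hIJ x.2⟩, fun x y h => ?_, fun x => hfX ⟨x, hIJ x.2⟩⟩
  simpa [Subtype.ext_iff] using hf h

theorem augment (hX : Pairwise (Function.onFun Disjoint X)) ⦃I J : Set α⦄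
    (hI : IsPartialRainbow X I) (hJ : IsPartialRainbow X J) (hlt : I.encard < J.encard) :
    ∃ e ∈ J, e ∉ I ∧ IsPartialRainbow X (insert e I) := by
  classical
  obtain ⟨f, hf, hfX⟩ := hI
  obtain ⟨g, hg, hgX⟩ := hJ
  have hIr : (Set.range f).encard = I.encard :=
    ENat.card_congr (Equiv.ofInjective f hf).symm
  have hJr : (Set.range g).encard = J.encard :=
    ENat.card_congr (Equiv.ofInjective g hg).symm
  have hns : ¬ Set.range g ⊆ Set.range f := by
    intro h
    have := Set.encard_le_encard h
    rw [hIr, hJr] at this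
    exact absurd hlt (not_lt.2 this)
  obtain ⟨_, ⟨e, rfl⟩, hef⟩ := Set.not_subset.1 hns
  have heI : (e : α) ∉ I := by
    intro h
    refine hef ⟨⟨e, h⟩, ?_⟩
    by_contra hne
    exact Set.disjoint_left.1 (hX hne) (hfX ⟨e, h⟩) (hgX e)
  refine ⟨e, e.2, heI, fun x => if h : (x : α) ∈ I then f ⟨x, h⟩ else g e, ?_, ?_⟩
  · intro x y hxy
    by_cases hx : (x : α) ∈ I <;> by_cases hy : (y : α) ∈ I
    · simp only [hx, hy, dif_pos] at hxy
      simpa [Subtype.ext_iff] using hf hxy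
    · simp only [hx, hy, dif_pos, dif_neg, not_false_eq_true] at hxy
      exact absurd ⟨_, hxy⟩ hef
    · simp only [hx, hy, dif_pos, dif_neg, not_false_eq_true] at hxy
      exact absurd ⟨_, hxy.symm⟩ hef
    · exact Subtype.ext ((x.2.resolve_right hx).trans (y.2.resolve_right hy).symm)
  · intro x
    by_cases hx : (x : α) ∈ I
    · simp only [hx, dif_pos]
      exact hfX ⟨x, hx⟩
    · simp only [hx, dif_neg, not_false_eq_true]
      rw [x.2.resolve_right hx]
      exact hgX e

theorem encard_le (I : Set α) (hI : IsPartialRainbow X I) : I.encard ≤ m := by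
  obtain ⟨f, hf, _⟩ := hI
  have hIr : (Set.range f).encard = I.encard :=
    ENat.card_congr (Equiv.ofInjective f hf).symm
  rw [← hIr]
  exact (Set.encard_le_encard (Set.subset_univ _)).trans (by simp [Set.encard_univ])

theorem subset_iUnion (I : Set α) (hI : IsPartialRainbow X I) : I ⊆ ⋃ i, X i := by
  obtain ⟨f, _, hfX⟩ := hI
  exact fun x hx => Set.mem_iUnion.2 ⟨f ⟨x, hx⟩, hfX ⟨x, hx⟩⟩

end IsPartialRainbow

/-- The partition matroid on `X₁ ⊔ ⋯ ⊔ Xₘ`: its independent sets are the partial rainbow sets. -/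
def partitionMatroid {α : Type*} {m : ℕ} (X : Fin m → Set α)
    (hX : Pairwise (Function.onFun Disjoint X)) : Matroid α :=
  (IndepMatroid.ofBddAugment (⋃ i, X i) (IsPartialRainbow X) IsPartialRainbow.empty
    IsPartialRainbow.subset (IsPartialRainbow.augment hX) ⟨m, IsPartialRainbow.encard_le⟩
    IsPartialRainbow.subset_iUnion).matroid

theorem partitionMatroid_indep_iff {α : Type*} {m : ℕ} (X : Fin m → Set α)
    (hX : Pairwise (Function.onFun Disjoint X)) (s : Set α) :
    (partitionMatroid X hX).Indep s ↔ IsPartialRainbow X s := by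
  rw [partitionMatroid, IndepMatroid.matroid_Indep, IndepMatroid.ofBddAugment_indep]

theorem partitionMatroid_ground {α : Type*} {m : ℕ} (X : Fin m → Set α)
    (hX : Pairwise (Function.onFun Disjoint X)) : (partitionMatroid X hX).E = ⋃ i, X i := by
  rw [partitionMatroid, IndepMatroid.matroid_E, IndepMatroid.ofBddAugment_E]

/-- The simplicial complex whose simplices are the finite independent sets of the matroid `M`. -/
def indepComplex {α : Type*} (M : Matroid α) : LowerSet (Finset α) where
  carrier := {s | M.Indep (s : Set α)}
  lower' := fun _ _ hts hs => Matroid.Indep.subset hs (Finset.coe_subset.2 hts)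

/-! Colour each element by the index of its class; $P\cap\mathcal N$ is then the complex of
independent sets on which the colouring is injective. Deleting a vertex $e$ keeps a complex of this
type, and its link is one for $\mathcal N/e$ with the colour of $e$ removed. Mayer-Vietoris
(`acyclic_of_deletion_of_link`) gives $\eta(K)\ge\min(\eta(K\setminus e),\eta(\mathrm{lk}\,e)+1)$.

The induction (`acyclic_rainbowComplex`) carries an independent set $T$ whose elements are alone in
their colours, and a list of fresh colours of sufficient rank. The first listed colour contains some
$z$ extending $T$. Its other elements are removed one at a time by deletion and link, after which
$z$ joins $T$. A link costs one rank, at most one element of $T$, and two places in the list, which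
is why its length is $2\ell-1$. Once $|T|=\ell$, no list is needed: removing the remaining vertices
leaves the full simplex on $T$. -/

namespace ReducedHomology

/-! ### Chains, cones and links -/

section Chains

variable {α : Type*}

/-- A linear map sends chains into a submodule if it does so on simplices. -/
theorem map_mem_of_mem_chains {K : LowerSet (Finset α)} {k : ℕ}
    (f : (Finset α →₀ ℚ) →ₗ[ℚ] (Finset α →₀ ℚ)) (p : Submodule ℚ (Finset α →₀ ℚ))
    (h : ∀ s ∈ K, s.card = k → f (Finsupp.single s 1) ∈ p) {x : Finset α →₀ ℚ}
    (hx : x ∈ chains K k) : f x ∈ p := by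
  rw [chains, Finsupp.supported_eq_span_single] at hx
  refine (Submodule.span_le.2 ?_ : Submodule.span ℚ _ ≤ p.comap f) hx
  rintro _ ⟨s, ⟨hs, hk⟩, rfl⟩
  exact h s hs hk

theorem single_mem_chains {K : LowerSet (Finset α)} {k : ℕ} {s : Finset α} (hs : s ∈ K)
    (hk : s.card = k) (a : ℚ) : Finsupp.single s a ∈ chains K k :=
  Finsupp.single_mem_supported ℚ _ ⟨hs, hk⟩

theorem chains_mono {K L : LowerSet (Finset α)} (h : K ≤ L) (k : ℕ) : chains K k ≤ chains L k :=
  Finsupp.supported_mono fun _ hs => ⟨h hs.1, hs.2⟩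

end Chains

variable {α : Type*} [LinearOrder α]

theorem sign_mul_self (v : α) (s : Finset α) : sign v s * sign v s = 1 := by
  rw [sign, ← pow_add]
  exact Even.neg_one_pow ⟨_, rfl⟩

theorem sign_mul_sign_erase_of_ne {s : Finset α} {v w : α} (hv : v ∈ s) (hw : w ∈ s)
    (hvw : v ≠ w) : sign v s * sign w (s.erase v) = -(sign w s * sign v (s.erase w)) := by
  rcases lt_or_gt_of_ne hvw with h | h
  · exact sign_mul_sign_erase hv h
  · rw [sign_mul_sign_erase hw h, neg_neg]

theorem boundary_single' (s : Finset α) (a : ℚ) :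
    boundary (Finsupp.single s a) = ∑ v ∈ s, Finsupp.single (s.erase v) (a * sign v s) := by
  simp [boundary, Finset.smul_sum]

/-- The cone with apex `e` over a chain; simplices that contain `e` are sent to zero. -/
noncomputable def cone (e : α) : (Finset α →₀ ℚ) →ₗ[ℚ] (Finset α →₀ ℚ) :=
  Finsupp.linearCombination ℚ
    (fun s => if e ∈ s then 0 else Finsupp.single (insert e s) (sign e (insert e s)))

/-- The link of `e` in a chain; simplices that do not contain `e` are sent to zero. -/
noncomputable def linkMap (e : α) : (Finset α →₀ ℚ) →ₗ[ℚ] (Finset α →₀ ℚ) :=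
  Finsupp.linearCombination ℚ
    (fun s => if e ∈ s then Finsupp.single (s.erase e) (sign e s) else 0)

theorem cone_single_of_mem {e : α} {s : Finset α} (h : e ∈ s) (a : ℚ) :
    cone e (Finsupp.single s a) = 0 := by
  simp [cone, h]

theorem cone_single_of_notMem {e : α} {s : Finset α} (h : e ∉ s) (a : ℚ) :
    cone e (Finsupp.single s a) = Finsupp.single (insert e s) (a * sign e (insert e s)) := by
  simp [cone, h]

theorem linkMap_single_of_mem {e : α} {s : Finset α} (h : e ∈ s) (a : ℚ) :
    linkMap e (Finsupp.single s a) = Finsupp.single (s.erase e) (a * sign e s) := by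
  simp [linkMap, h]

theorem linkMap_single_of_notMem {e : α} {s : Finset α} (h : e ∉ s) (a : ℚ) :
    linkMap e (Finsupp.single s a) = 0 := by
  simp [linkMap, h]

/-- Coning is a chain contraction on all chains: on a simplex containing `e`, only the face opposite
`e` survives coning, and it gives the simplex back. -/
theorem boundary_cone_add_cone_boundary (e : α) (x : Finset α →₀ ℚ) :
    boundary (cone e x) + cone e (boundary x) = x := by
  suffices h : (boundary (α := α)).comp (cone e) + (cone e).comp boundary = LinearMap.id from
    LinearMap.congr_fun h x
  refine Finsupp.lhom_ext' fun s => LinearMap.ext_ring ?_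
  simp only [LinearMap.comp_apply, LinearMap.add_apply, Finsupp.lsingle_apply, LinearMap.id_apply]
  by_cases he : e ∈ s
  · rw [cone_single_of_mem he, map_zero, zero_add, boundary_single', map_sum,
      Finset.sum_eq_single_of_mem e he, cone_single_of_notMem (Finset.notMem_erase e s),
      Finset.insert_erase he, one_mul, sign_mul_self]
    intro v hv hve
    exact cone_single_of_mem (Finset.mem_erase.2 ⟨hve.symm, he⟩) _
  · rw [cone_single_of_notMem he, boundary_single', boundary_single', map_sum,
      Finset.sum_insert he, Finset.erase_insert he, one_mul, sign_mul_self, add_assoc,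
      ← Finset.sum_add_distrib, Finset.sum_eq_zero, add_zero]
    intro v hv
    have hve : v ≠ e := fun h => he (h ▸ hv)
    have hset : (insert e s).erase v = insert e (s.erase v) :=
      Finset.erase_insert_of_ne hve.symm
    rw [cone_single_of_notMem (fun h => he (Finset.mem_of_mem_erase h)), hset,
      ← Finsupp.single_add, Finsupp.single_eq_zero]
    have h1 := sign_mul_sign_erase_of_ne (Finset.mem_insert_of_mem hv)
      (Finset.mem_insert_self e s) hve
    rw [Finset.erase_insert he, hset] at h1
    have h2 := sign_mul_self e (insert e (s.erase v))
    have h3 := sign_mul_self e (insert e s)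
    linear_combination sign e (insert e s) * sign e (insert e (s.erase v)) * h1
      - sign e (insert e s) * sign v (insert e s) * h2
      - sign e (insert e (s.erase v)) * sign v s * h3

/-- Removing two vertices in either order gives opposite signs. Hence the link of a cycle is a
cycle. -/
theorem linkMap_boundary (e : α) (x : Finset α →₀ ℚ) :
    linkMap e (boundary x) = -boundary (linkMap e x) := by
  suffices h : (linkMap e).comp (boundary (α := α)) = -(boundary.comp (linkMap e)) from
    LinearMap.congr_fun h x
  refine Finsupp.lhom_ext' fun s => LinearMap.ext_ring ?_
  simp only [LinearMap.comp_apply, LinearMap.neg_apply, Finsupp.lsingle_apply]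
  rw [boundary_single', map_sum]
  by_cases he : e ∈ s
  · rw [linkMap_single_of_mem he, boundary_single', ← Finset.add_sum_erase s _ he,
      linkMap_single_of_notMem (Finset.notMem_erase e s), zero_add, ← Finset.sum_neg_distrib]
    refine Finset.sum_congr rfl fun v hv => ?_
    obtain ⟨hve, hvs⟩ := Finset.mem_erase.1 hv
    rw [linkMap_single_of_mem (Finset.mem_erase.2 ⟨hve.symm, he⟩), Finset.erase_right_comm,
      ← Finsupp.single_neg, one_mul, one_mul, sign_mul_sign_erase_of_ne hvs he hve]
  · rw [linkMap_single_of_notMem he, map_zero, neg_zero]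
    exact Finset.sum_eq_zero fun v _ =>
      linkMap_single_of_notMem (fun h => he (Finset.mem_of_mem_erase h)) _

theorem boundaries_mono {K L : LowerSet (Finset α)} (h : K ≤ L) (k : ℕ) :
    boundaries K k ≤ boundaries L k :=
  Submodule.map_mono (chains_mono h _)

theorem cone_mem_chains {K L : LowerSet (Finset α)} {e : α} (h : ∀ s ∈ L, insert e s ∈ K) {k : ℕ}
    {x : Finset α →₀ ℚ} (hx : x ∈ chains L k) : cone e x ∈ chains K (k + 1) := by
  refine map_mem_of_mem_chains _ _ (fun s hs hk => ?_) hx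
  by_cases he : e ∈ s
  · rw [cone_single_of_mem he]
    exact zero_mem _
  · rw [cone_single_of_notMem he]
    exact single_mem_chains (h s hs) (by rw [Finset.card_insert_of_notMem he, hk]) _

/-- All reduced homology of `K` in dimensions below `l - 1` vanishes. -/
def Acyclic (K : LowerSet (Finset α)) (l : ℕ) : Prop :=
  ∀ k < l, cycles K k ≤ boundaries K k

theorem le_eta_of_acyclic {K : LowerSet (Finset α)} {l : ℕ} (hK : ∅ ∈ K) (h : Acyclic K l) :
    (l : ℕ∞) ≤ eta K := by
  have hne : K ≠ ⊥ := fun h => by simp [h] at hK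
  rw [eta, if_neg hne]
  refine le_sInf ?_
  rintro _ ⟨k, rfl, hnt⟩
  by_contra hlt
  have hk : k < l := by exact_mod_cast not_le.1 hlt
  rw [Submodule.Quotient.nontrivial_iff] at hnt
  exact hnt (Submodule.submoduleOf_eq_top.2 (h k hk))

/-- A cone is acyclic. -/
theorem acyclic_of_cone {K : LowerSet (Finset α)} {e : α} (h : ∀ s ∈ K, insert e s ∈ K) (l : ℕ) :
    Acyclic K l := by
  intro k _ x hx
  refine ⟨cone e x, cone_mem_chains h hx.1, ?_⟩
  have := boundary_cone_add_cone_boundary e x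
  rwa [LinearMap.mem_ker.1 hx.2, map_zero, add_zero] at this

/-- The Mayer-Vietoris bound: vanishing of homology for the deletion `D` and the link `L` of a
vertex `e` passes to the complex `K`. -/
theorem acyclic_of_deletion_of_link {K D L : LowerSet (Finset α)} {e : α} {l : ℕ}
    (hD : ∀ s, s ∈ D ↔ s ∈ K ∧ e ∉ s) (hL : ∀ s, s ∈ L ↔ insert e s ∈ K ∧ e ∉ s)
    (hDl : Acyclic D l) (hLl : Acyclic L (l - 1)) : Acyclic K l := by
  intro k hk x hx
  have hDK : D ≤ K := fun s hs => ((hD s).1 hs).1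
  have hLD : L ≤ D := fun s hs => (hD s).2
    ⟨K.lower (Finset.subset_insert e s) ((hL s).1 hs).1, ((hL s).1 hs).2⟩
  have hx0 : boundary x = 0 := hx.2
  have hlink : ∃ y ∈ chains L k, boundary y = linkMap e x := by
    -- For `k = 0` the only simplex is `∅`, whose link part is zero, so nothing is asked of `L`.
    rcases k with _ | k
    · refine ⟨0, zero_mem _, ?_⟩
      rw [map_zero, eq_comm, ← Submodule.mem_bot ℚ]
      refine map_mem_of_mem_chains _ _ (fun s _ hs => ?_) hx.1
      rw [Finset.card_eq_zero.1 hs, linkMap_single_of_notMem (Finset.notMem_empty e)]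
      exact zero_mem _
    · refine hLl k (by omega) ⟨?_, ?_⟩
      · refine map_mem_of_mem_chains _ _ (fun s hs hk => ?_) hx.1
        by_cases he : e ∈ s
        · rw [linkMap_single_of_mem he]
          refine single_mem_chains ((hL _).2 ⟨?_, Finset.notMem_erase e s⟩) ?_ _
          · rwa [Finset.insert_erase he]
          · rw [Finset.card_erase_of_mem he, hk, Nat.add_sub_cancel]
        · rw [linkMap_single_of_notMem he]
          exact zero_mem _
      · have := linkMap_boundary e x
        rw [hx0, map_zero, eq_comm, neg_eq_zero] at this
        exact this
  obtain ⟨y, hy, hyx⟩ := hlink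
  have hrest : x - cone e (linkMap e x) ∈ chains D k := by
    have : x - cone e (linkMap e x) =
        (LinearMap.id - (cone e).comp (linkMap e) : (Finset α →₀ ℚ) →ₗ[ℚ] (Finset α →₀ ℚ)) x := rfl
    rw [this]
    refine map_mem_of_mem_chains _ _ (fun s hs hk => ?_) hx.1
    simp only [LinearMap.sub_apply, LinearMap.id_apply, LinearMap.comp_apply]
    by_cases he : e ∈ s
    · rw [linkMap_single_of_mem he, cone_single_of_notMem (Finset.notMem_erase e s),
        Finset.insert_erase he, one_mul, sign_mul_self, sub_self]
      exact zero_mem _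
    · rw [linkMap_single_of_notMem he, map_zero, sub_zero]
      exact single_mem_chains ((hD s).2 ⟨hs, he⟩) hk _
  have hcone := boundary_cone_add_cone_boundary e y
  rw [hyx] at hcone
  -- Adding the boundary of the cone over `y` replaces the part of `x` through `e` by `y`, giving a
  -- homologous cycle in `D`.
  have hsum : x + boundary (cone e y) = x - cone e (linkMap e x) + y := by
    rw [eq_sub_of_add_eq hcone]
    abel
  have hmem : x + boundary (cone e y) ∈ boundaries K k := by
    refine boundaries_mono hDK k (hDl k hk ⟨?_, ?_⟩)
    · rw [hsum]
      exact add_mem hrest (chains_mono hLD k hy)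
    · change boundary _ = 0
      rw [map_add, hx0, boundary_boundary, add_zero]
  have hbd : boundary (cone e y) ∈ boundaries K k :=
    Submodule.mem_map_of_mem (cone_mem_chains (fun s hs => ((hL s).1 hs).1) hy)
  exact (Submodule.add_mem_iff_left _ hbd).1 hmem

end ReducedHomology

/-! ### Contraction of a nonloop and augmentation -/

namespace Matroid

variable {α : Type*}

/-- Contracting a nonloop lowers the rank of a set by at most one. -/
theorem IsNonloop.le_eRk_contractElem {M : Matroid α} {e : α} (he : M.IsNonloop e) {X : Set α}
    {n : ℕ} (h : (n : ℕ∞) + 1 ≤ M.eRk X) : (n : ℕ∞) ≤ (M ／ {e}).eRk X := by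
  -- A basis of `insert e X` through `e` loses only `e` on contraction.
  obtain ⟨J, hJ, heJ⟩ := he.indep.subset_isBasis'_of_subset
    (Set.singleton_subset_iff.2 (Set.mem_insert e X))
  have heJ' : e ∈ J := Set.singleton_subset_iff.1 heJ
  have hind : (M ／ {e}).Indep (J \ {e}) := he.contractElem_indep_iff.2
    ⟨fun h => h.2 rfl, by simpa [Set.insert_eq_of_mem heJ'] using hJ.indep⟩
  have hsub : J \ {e} ⊆ X := fun x hx => (hJ.subset hx.1).resolve_left hx.2
  refine le_trans ?_ (hind.encard_le_eRk_of_subset hsub)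
  have hcard : (n : ℕ∞) + 1 ≤ (J \ {e}).encard + 1 := by
    rw [Set.encard_sdiff_singleton_add_one heJ', hJ.encard_eq_eRk]
    exact h.trans (M.eRk_mono (Set.subset_insert e X))
  exact (ENat.add_le_add_iff_right ENat.one_ne_top).1 hcard

/-- A finite independent set has an element that extends a given smaller independent set of the
contraction by a nonloop. -/
theorem IsNonloop.exists_subset_indep_contractElem {M : Matroid α} {e : α} (he : M.IsNonloop e)
    {T : Finset α} (hT : M.Indep T) :
    ∃ T' ⊆ T, (M ／ {e}).Indep (T' : Set α) ∧ T'.card = T.card - 1 := by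
  rcases Nat.eq_zero_or_eq_succ_pred T.card with h0 | h1
  · exact ⟨∅, Finset.empty_subset T, by simp, by simp [h0]⟩
  · have hrk : ((T.card - 1 : ℕ) : ℕ∞) + 1 ≤ M.eRk T := by
      rw [hT.eRk_eq_encard, Set.encard_coe_eq_coe_finsetCard]
      exact_mod_cast h1.symm.le
    obtain ⟨I, hIT, hI, hIc⟩ := le_eRk_iff.1 (he.le_eRk_contractElem hrk)
    lift I to Finset α using T.finite_toSet.subset hIT
    refine ⟨I, Finset.coe_subset.1 hIT, hI, ?_⟩
    rw [Set.encard_coe_eq_coe_finsetCard] at hIc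
    exact_mod_cast hIc

/-- An independent set is extended by an element of any set of larger rank. -/
theorem Indep.exists_insert_of_lt_eRk {M : Matroid α} {T : Finset α} (hT : M.Indep T) {X : Set α}
    (h : (T.card : ℕ∞) + 1 ≤ M.eRk X) : ∃ z ∈ X, z ∉ T ∧ M.Indep (insert z (T : Set α)) := by
  have h' : ((T.card + 1 : ℕ) : ℕ∞) ≤ M.eRk X := by exact_mod_cast h
  obtain ⟨I, hIX, hI, hIc⟩ := le_eRk_iff.1 h'
  obtain ⟨z, hz, hzi⟩ := hT.augment hI (by
    rw [hIc, Set.encard_coe_eq_coe_finsetCard]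
    exact_mod_cast Nat.lt_succ_self _)
  exact ⟨z, hIX hz.1, hz.2, hzi⟩

end Matroid

open scoped Matroid

/-! ### Rainbow complexes and the induction -/

section RainbowComplex

variable {α ι : Type*}

/-- The independent sets of `N` inside `S` on which the colouring `c` is injective. -/
def rainbowComplex (N : Matroid α) (c : α → ι) (S : Finset α) : LowerSet (Finset α) where
  carrier := {s | s ⊆ S ∧ Set.InjOn c s ∧ N.Indep (s : Set α)}
  lower' := fun _ _ hts hs => ⟨hts.trans hs.1, hs.2.1.mono (Finset.coe_subset.2 hts),
    hs.2.2.subset (Finset.coe_subset.2 hts)⟩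

theorem mem_rainbowComplex {N : Matroid α} {c : α → ι} {S s : Finset α} :
    s ∈ rainbowComplex N c S ↔ s ⊆ S ∧ Set.InjOn c s ∧ N.Indep (s : Set α) := Iff.rfl

/-- `T` is an independent subset of `S` each element of which is alone in its colour class. -/
structure IsIsolated (N : Matroid α) (c : α → ι) (S T : Finset α) : Prop where
  subset : T ⊆ S
  indep : N.Indep (T : Set α)
  eq_of_color_eq : ∀ v ∈ S, ∀ t ∈ T, c v = c t → v = t

/-- The colours `a j` for `T.card ≤ j < 2 * l - 1` are distinct and do not occur in `T`, the first
of them has an element that extends `T` to a larger independent set, and the colour class of every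
other one has rank at least `min (j + 1) l`. -/
structure IsTail (N : Matroid α) (c : α → ι) (S T : Finset α) (l : ℕ) (a : ℕ → ι) : Prop where
  injOn : Set.InjOn a {j | T.card ≤ j ∧ j < 2 * l - 1}
  avoid : ∀ j, T.card ≤ j → j < 2 * l - 1 → ∀ t ∈ T, c t ≠ a j
  exists_insert : ∃ z ∈ S, c z = a T.card ∧ z ∉ T ∧ N.Indep (insert z (T : Set α))
  le_eRk : ∀ j, T.card < j → j < 2 * l - 1 →
    ((min (j + 1) l : ℕ) : ℕ∞) ≤ N.eRk {v | v ∈ S ∧ c v = a j}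

/-- Only the first colour class shrinks, and it needs no rank bound, just the witness `z`. -/
theorem IsTail.erase [DecidableEq α] {N : Matroid α} {c : α → ι} {S T : Finset α} {l : ℕ} {a : ℕ → ι} {e z : α}
    (h : IsTail N c S T l a) (hc : c e = a T.card)
    (hz : z ∈ S) (hcz : c z = a T.card)
    (hzT : z ∉ T) (hzi : N.Indep (insert z (T : Set α))) (hze : z ≠ e) :
    IsTail N c (S.erase e) T l a := by
  refine ⟨h.injOn, h.avoid, ⟨z, Finset.mem_erase.2 ⟨hze, hz⟩, hcz, hzT, hzi⟩, fun j h1 h2 => ?_⟩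
  refine (h.le_eRk j h1 h2).trans (N.eRk_mono fun v hv => ⟨Finset.mem_erase.2 ⟨?_, hv.1⟩, hv.2⟩)
  rintro rfl
  have := h.injOn (show _ ∧ _ from ⟨h1.le, h2⟩) (show _ ∧ _ from ⟨le_rfl, by omega⟩)
    (hv.2.symm.trans hc)
  omega

theorem IsIsolated.erase [DecidableEq α] {N : Matroid α} {c : α → ι} {S T : Finset α} {e : α}
    (h : IsIsolated N c S T) (heT : e ∉ T) : IsIsolated N c (S.erase e) T :=
  ⟨Finset.subset_erase.2 ⟨h.subset, heT⟩, h.indep,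
    fun v hv => h.eq_of_color_eq v (Finset.mem_of_mem_erase hv)⟩

theorem IsIsolated.extend [DecidableEq α] {N : Matroid α} {c : α → ι} {S T : Finset α} {z : α}
    (h : IsIsolated N c S T) (hz : z ∈ S) (hzi : N.Indep (insert z (T : Set α)))
    (huniq : ∀ v ∈ S, c v = c z → v = z) : IsIsolated N c S (insert z T) := by
  refine ⟨Finset.insert_subset hz h.subset, by rwa [Finset.coe_insert], fun v hv t ht => ?_⟩
  rcases Finset.mem_insert.1 ht with rfl | ht
  · exact huniq v hv
  · exact h.eq_of_color_eq v hv t ht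

/-- As `T.card + 2 ≤ l`, the next colour has rank at least `T.card + 2`, enough to augment `insert z
T`. -/
theorem IsTail.extend [DecidableEq α] {N : Matroid α} {c : α → ι} {S T : Finset α} {l : ℕ} {a : ℕ → ι} {z : α}
    (h : IsTail N c S T l a) (hcz : c z = a T.card) (hzT : z ∉ T)
    (hzi : N.Indep (insert z (T : Set α))) (hl : T.card + 1 < l) :
    IsTail N c S (insert z T) l a := by
  have hcard : (insert z T).card = T.card + 1 := Finset.card_insert_of_notMem hzT
  have hzi' : N.Indep ((insert z T : Finset α) : Set α) := by rwa [Finset.coe_insert]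
  refine ⟨fun i hi j hj hij => ?_, fun j h1 h2 t ht hct => ?_, ?_,
    fun j h1 h2 => h.le_eRk j (by omega) h2⟩
  · obtain ⟨hi1, hi2⟩ := hi
    obtain ⟨hj1, hj2⟩ := hj
    exact h.injOn (show _ ∧ _ from ⟨by omega, hi2⟩) (show _ ∧ _ from ⟨by omega, hj2⟩) hij
  · rcases Finset.mem_insert.1 ht with rfl | ht
    · have := h.injOn (show _ ∧ _ from ⟨le_rfl, by omega⟩) (show _ ∧ _ from ⟨by omega, h2⟩)
        (hcz.symm.trans hct)
      omega
    · exact h.avoid j (by omega) h2 t ht hct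
  · obtain ⟨x, hx, hxT, hxi⟩ := hzi'.exists_insert_of_lt_eRk
      (le_trans (by exact_mod_cast (show (insert z T).card + 1 ≤ min (T.card + 1 + 1) l by
        omega)) (h.le_eRk (T.card + 1) (by omega) (by omega)))
    exact ⟨x, hx.1, by rw [hcard]; exact hx.2, hxT, hxi⟩

variable [DecidableEq ι]

/-- Dropping at most one element of `T` restores independence after contraction. Isolation keeps `T`
clear of the colour of `e`. -/
theorem IsIsolated.link {N : Matroid α} {c : α → ι} {S T : Finset α} {e : α}
    (h : IsIsolated N c S T) (he : e ∈ S) (heT : e ∉ T) (hnl : N.IsNonloop e) :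
    ∃ T' ⊆ T, IsIsolated (N ／ {e}) c (S.filter fun v => c v ≠ c e) T' ∧
      T'.card = T.card - 1 := by
  obtain ⟨T', hT'T, hT', hcard⟩ := hnl.exists_subset_indep_contractElem h.indep
  refine ⟨T', hT'T, ⟨fun t ht => ?_, hT', fun v hv t ht => ?_⟩, hcard⟩
  · refine Finset.mem_filter.2 ⟨h.subset (hT'T ht), fun hc => heT ?_⟩
    rw [h.eq_of_color_eq e he t (hT'T ht) hc.symm]
    exact hT'T ht
  · exact h.eq_of_color_eq v (Finset.mem_filter.1 hv).1 t (hT'T ht)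

/-- Shifting by two matches the bound `2 * (l - 1) - 1` and skips `a T.card`, the colour of `e`,
because `T'.card + 2 > T.card`. The later classes survive whole, and their rank drops by at most
one. -/
theorem IsTail.link {N : Matroid α} {c : α → ι} {S T T' : Finset α} {l : ℕ} {a : ℕ → ι} {e : α}
    (h : IsTail N c S T l a) (hnl : N.IsNonloop e) (hc : c e = a T.card) (hT'T : T' ⊆ T)
    (hT' : (N ／ {e}).Indep (T' : Set α)) (hcard : T'.card = T.card - 1) (hl : T.card < l)
    (hl' : T'.card < l - 1) :
    IsTail (N ／ {e}) c (S.filter fun v => c v ≠ c e) T' (l - 1) fun j => a (j + 2) := by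
  have hclass : ∀ j, T'.card ≤ j → j < 2 * (l - 1) - 1 →
      ((min (j + 3) l - 1 : ℕ) : ℕ∞) ≤
        (N ／ {e}).eRk {v | v ∈ S.filter (fun v => c v ≠ c e) ∧ c v = a (j + 2)} := by
    intro j h1 h2
    have hset : {v | v ∈ S.filter (fun v => c v ≠ c e) ∧ c v = a (j + 2)} =
        {v | v ∈ S ∧ c v = a (j + 2)} := by
      ext v
      simp only [Finset.mem_filter, Set.mem_ofPred_eq]
      refine ⟨fun hv => ⟨hv.1.1, hv.2⟩, fun hv => ⟨⟨hv.1, fun hve => ?_⟩, hv.2⟩⟩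
      have := h.injOn (show _ ∧ _ from ⟨by omega, by omega⟩)
        (show _ ∧ _ from ⟨le_rfl, by omega⟩) (hv.2.symm.trans (hve.trans hc))
      omega
    rw [hset]
    refine hnl.le_eRk_contractElem (le_trans ?_ (h.le_eRk (j + 2) (by omega) (by omega)))
    have : min (j + 3) l - 1 + 1 ≤ min (j + 2 + 1) l := by omega
    exact_mod_cast this
  refine ⟨fun i hi j hj hij => ?_, fun j h1 h2 t ht => ?_, ?_, fun j h1 h2 => ?_⟩
  · obtain ⟨hi1, hi2⟩ := hi
    obtain ⟨hj1, hj2⟩ := hj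
    have := h.injOn (show _ ∧ _ from ⟨by omega, by omega⟩)
      (show _ ∧ _ from ⟨by omega, by omega⟩) hij
    omega
  · exact h.avoid (j + 2) (by omega) (by omega) t (hT'T ht)
  · obtain ⟨z, hz, hzT, hzi⟩ := hT'.exists_insert_of_lt_eRk
      (le_trans (by exact_mod_cast (show T'.card + 1 ≤ min (T'.card + 3) l - 1 by omega))
        (hclass T'.card le_rfl (by omega)))
    exact ⟨z, hz.1, hz.2, hzT, hzi⟩
  · refine le_trans ?_ (hclass j h1.le h2)
    exact_mod_cast (show min (j + 1) (l - 1) ≤ min (j + 3) l - 1 by omega)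

variable [LinearOrder α]

open ReducedHomology in
/-- The deletion-link bound for rainbow complexes: the link of `e` is the rainbow complex of the
contraction on the elements of the other colours. -/
theorem acyclic_rainbowComplex_of_erase {N : Matroid α} {c : α → ι} {S : Finset α} {l : ℕ} {e : α}
    (he : e ∈ S) (hdel : Acyclic (rainbowComplex N c (S.erase e)) l)
    (hlink : N.IsNonloop e →
      Acyclic (rainbowComplex (N ／ {e}) c (S.filter fun v => c v ≠ c e)) (l - 1)) :
    Acyclic (rainbowComplex N c S) l := by
  by_cases hnl : N.IsNonloop e
  · refine acyclic_of_deletion_of_link (e := e) (fun s => ?_) (fun s => ?_) hdel (hlink hnl)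
    · simp only [mem_rainbowComplex, Finset.subset_erase]
      tauto
    · simp only [mem_rainbowComplex, hnl.contractElem_indep_iff, Finset.coe_insert,
        Finset.mem_coe]
      constructor
      · rintro ⟨hs, hinj, hes, hi⟩
        refine ⟨⟨Finset.insert_subset he fun v hv => (Finset.mem_filter.1 (hs hv)).1,
          (Set.injOn_insert hes).2 ⟨hinj, ?_⟩, hi⟩, hes⟩
        rintro ⟨v, hv, hve⟩
        exact (Finset.mem_filter.1 (hs hv)).2 hve
      · rintro ⟨⟨hs, hinj, hi⟩, hes⟩
        obtain ⟨hinj', hce⟩ := (Set.injOn_insert hes).1 hinj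
        exact ⟨fun v hv => Finset.mem_filter.2 ⟨hs (Finset.mem_insert_of_mem hv),
          fun hve => hce ⟨v, hv, hve⟩⟩, hinj', hes, hi⟩
  -- If `e` is not a nonloop, it lies in no simplex.
  · have : rainbowComplex N c S = rainbowComplex N c (S.erase e) := by
      ext s
      simp only [SetLike.mem_coe, mem_rainbowComplex, Finset.subset_erase]
      refine ⟨fun h => ⟨⟨h.1, fun hes => hnl ?_⟩, h.2⟩, fun h => ⟨h.1.1, h.2⟩⟩
      exact h.2.2.isNonloop_of_mem hes
    rwa [this]

open ReducedHomology in
theorem acyclic_rainbowComplex (c : α → ι) (l : ℕ) (N : Matroid α) (S T : Finset α)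
    (hT : IsIsolated N c S T) (hTl : T.card ≤ l) (htail : T.card < l → ∃ a, IsTail N c S T l a) :
    Acyclic (rainbowComplex N c S) l := by
  induction l generalizing N S T with
  | zero => exact fun k hk => absurd hk (Nat.not_lt_zero k)
  | succ l ihl =>
  -- Deletions and enlargements of `T` lower this number; links lower `l` instead.
  induction hn : (S \ T).card using Nat.strong_induction_on generalizing S T with
  | _ n ihn =>
  rcases hTl.lt_or_eq with hlt | heq
  · obtain ⟨a, ha⟩ := htail hlt
    obtain ⟨z, hz, hcz, hzT, hzi⟩ := ha.exists_insert
    by_cases huniq : ∀ v ∈ S, c v = c z → v = z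
    · refine ihn (S \ insert z T).card ?_ S (insert z T) (hT.extend hz hzi huniq) ?_ ?_ rfl
      · rw [← hn]
        exact Finset.card_lt_card ⟨Finset.sdiff_subset_sdiff subset_rfl (Finset.subset_insert z T),
          fun h => (Finset.mem_sdiff.1 (h (Finset.mem_sdiff.2 ⟨hz, hzT⟩))).2
            (Finset.mem_insert_self z T)⟩
      · rw [Finset.card_insert_of_notMem hzT]
        exact hlt
      · rw [Finset.card_insert_of_notMem hzT]
        exact fun h => ⟨a, ha.extend hcz hzT hzi h⟩
    · push Not at huniq
      obtain ⟨e, he, hce, hez⟩ := huniq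
      have heT : e ∉ T := fun h => ha.avoid T.card le_rfl (by omega) e h (hce.trans hcz)
      refine acyclic_rainbowComplex_of_erase he ?_ fun hnl => ?_
      · refine ihn ((S.erase e) \ T).card ?_ (S.erase e) T (hT.erase heT) hTl
          (fun h => ⟨a, ha.erase (hce.trans hcz) hz hcz hzT hzi hez.symm⟩) rfl
        rw [← hn]
        exact Finset.card_lt_card ⟨Finset.sdiff_subset_sdiff (Finset.erase_subset e S) subset_rfl,
          fun h => Finset.notMem_erase e S
            (Finset.mem_sdiff.1 (h (Finset.mem_sdiff.2 ⟨he, heT⟩))).1⟩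
      · obtain ⟨T', hT'T, hT', hcard⟩ := hT.link he heT hnl
        exact ihl _ _ T' hT' (by omega) fun h =>
          ⟨_, ha.link hnl (hce.trans hcz) hT'T hT'.indep hcard hlt h⟩
  -- With `T` full, a link leaves `T'` full for `l`, so no tail is ever needed again.
  · by_cases hST : S ⊆ T
    · have hS : S = T := hST.antisymm hT.subset
      subst hS
      obtain ⟨e, he⟩ : S.Nonempty := Finset.card_pos.1 (by omega)
      refine acyclic_of_cone (e := e) (fun s hs => ?_) _
      have hsub := Finset.insert_subset he hs.1
      exact ⟨hsub, fun v hv t ht => hT.eq_of_color_eq v (hsub hv) t (hsub ht),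
        hT.indep.subset (Finset.coe_subset.2 hsub)⟩
    · obtain ⟨e, he, heT⟩ := Finset.not_subset.1 hST
      refine acyclic_rainbowComplex_of_erase he ?_ fun hnl => ?_
      · refine ihn ((S.erase e) \ T).card ?_ (S.erase e) T (hT.erase heT) hTl
          (fun h => absurd heq h.ne) rfl
        rw [← hn]
        exact Finset.card_lt_card ⟨Finset.sdiff_subset_sdiff (Finset.erase_subset e S) subset_rfl,
          fun h => Finset.notMem_erase e S
            (Finset.mem_sdiff.1 (h (Finset.mem_sdiff.2 ⟨he, heT⟩))).1⟩
      · obtain ⟨T', hT'T, hT', hcard⟩ := hT.link he heT hnl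
        exact ihl _ _ T' hT' (by omega) fun h => by omega

end RainbowComplex

/-- For a colouring whose classes are the `X i`, the partial rainbow sets are the sets inside the
union of the `X i` on which the colouring is injective. -/
theorem isPartialRainbow_iff_injOn {α : Type*} {m : ℕ} {X : Fin m → Set α} {c : α → Fin m}
    (hc : ∀ i, ∀ x ∈ X i, c x = i) {s : Set α} :
    IsPartialRainbow X s ↔ s ⊆ ⋃ i, X i ∧ Set.InjOn c s := by
  constructor
  · intro h
    refine ⟨IsPartialRainbow.subset_iUnion s h, fun x hx y hy hxy => ?_⟩
    obtain ⟨f, hf, hfX⟩ := h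
    rw [hc _ _ (hfX ⟨x, hx⟩), hc _ _ (hfX ⟨y, hy⟩)] at hxy
    exact congrArg Subtype.val (hf hxy)
  · rintro ⟨hs, hinj⟩
    refine ⟨fun x => c x, fun x y hxy => Subtype.ext (hinj x.2 y.2 hxy), fun x => ?_⟩
    obtain ⟨i, hi⟩ := Set.mem_iUnion.1 (hs x.2)
    change (x : α) ∈ X (c x)
    rwa [hc i _ hi]

theorem lemma3p1 {α : Type*} [LinearOrder α] (l m : ℕ) (hl : 1 ≤ l) (hm : 2 * l - 1 ≤ m)
    (X : Fin m → Set α) (hX : Pairwise (Function.onFun Disjoint X))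
    (N : Matroid α) [N.Finite] (hXN : ∀ i, X i ⊆ N.E)
    (i : Fin (2 * l - 1) → Fin m) (hi : Function.Injective i)
    (hrank : ∀ j : Fin (2 * l - 1),
      ((min ((j : ℕ) + 1) l : ℕ) : ℕ∞) ≤ N.eRk (X (i j))) :
    (l : ℕ∞) ≤ ReducedHomology.eta
      (indepComplex (partitionMatroid X hX) ⊓ indepComplex N) := by
  classical
  have hfin : (⋃ i, X i).Finite := N.ground_finite.subset (Set.iUnion_subset hXN)
  obtain ⟨S, hS⟩ := hfin.exists_finset_coe
  have hm0 : 0 < m := by omega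
  obtain ⟨c, hc⟩ : ∃ c : α → Fin m, ∀ i, ∀ x ∈ X i, c x = i := by
    -- The colour outside the union is arbitrary.
    refine ⟨fun x => if h : ∃ i, x ∈ X i then h.choose else ⟨0, hm0⟩, fun i x hx => ?_⟩
    have h : ∃ i, x ∈ X i := ⟨i, hx⟩
    simp only [dif_pos h]
    by_contra hne
    exact Set.disjoint_left.1 (hX hne) h.choose_spec hx
  have hcomplex : indepComplex (partitionMatroid X hX) ⊓ indepComplex N =
      rainbowComplex N c S := by
    ext s
    change (partitionMatroid X hX).Indep (s : Set α) ∧ N.Indep (s : Set α) ↔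
      s ⊆ S ∧ Set.InjOn c s ∧ N.Indep (s : Set α)
    rw [partitionMatroid_indep_iff, isPartialRainbow_iff_injOn hc, ← hS, Finset.coe_subset,
      and_assoc]
  rw [hcomplex]
  refine ReducedHomology.le_eta_of_acyclic (by simp [mem_rainbowComplex])
    (acyclic_rainbowComplex c l N S ∅ ⟨Finset.empty_subset S, by simp, by simp⟩ (Nat.zero_le l)
      fun _ => ?_)
  have h0 : 0 < 2 * l - 1 := by omega
  have hclass : ∀ k : Fin m, {v | v ∈ S ∧ c v = k} = X k := by
    intro k
    ext v
    rw [Set.mem_ofPred_eq, ← Finset.mem_coe, hS, Set.mem_iUnion]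
    constructor
    · rintro ⟨⟨k', hv⟩, hk⟩
      rwa [← hk, hc k' v hv]
    · exact fun hv => ⟨⟨k, hv⟩, hc k v hv⟩
  -- The induction starts from `T = ∅` with all $2\ell-1$ colours; values beyond the list play no
  -- role.
  refine ⟨fun j => if h : j < 2 * l - 1 then i ⟨j, h⟩ else ⟨0, hm0⟩, ?_, by simp, ?_, ?_⟩
  · rintro j ⟨-, hj⟩ k ⟨-, hk⟩ hjk
    simp only [dif_pos hj, dif_pos hk] at hjk
    exact congrArg Fin.val (hi hjk)
  · have hr := hrank ⟨0, h0⟩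
    rw [← hclass] at hr
    obtain ⟨z, hz, hzT, hzi⟩ := (show N.Indep ((∅ : Finset α) : Set α) by
      simp).exists_insert_of_lt_eRk (le_trans (by
        exact_mod_cast (show (∅ : Finset α).card + 1 ≤ min (0 + 1) l by simp [hl])) hr)
    exact ⟨z, hz.1, by simpa [h0] using hz.2, hzT, hzi⟩
  · intro j _ hj
    simp only [dif_pos hj, hclass]
    exact hrank ⟨j, hj⟩
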